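/- Let $\lambda_b,P_b,\sigma,L,R_L,C,r_c,R_t,B_w>0$, $\rho_a\in(0,1)$, let $m_t\ge 1$ be an integer, $\alpha_c\in\mathbb R$, $0<a_t<a_c$ with $a_c+a_t=1$, and $\gamma_{SIC}^{th}>0$ with $\gamma_{SIC}^{th}a_t<a_c$. Put $\gamma_t^{th}=2^{R_t/B_w}-1$, $\eta_t=m_t(m_t!)^{-1/m_t}$, $$C_{RIS,E}^2=\frac1\pi\int_0^\pi\Big(\tfrac{L}{4\pi}\big(\cos(\rho_a\theta)+\cos((1-\rho_a)\theta)\big)\Big)^2d\theta ,$$ $$\Upsilon=\max\Big(\frac{\gamma_{SIC}^{th}}{a_c-\gamma_{SIC}^{th}a_t},\ \frac{\gamma_t^{th}}{a_t},\ \gamma_c^E\Big),\qquad \gamma_c^E=\mathbb E\Big[\frac{P_b\,|h_c|^2\,C\,r_c^{-\alpha_c}}{I_c+\sigma^2}\Big],\qquad I_c=\sum_i P_b|h_i|^2C\|\mathbf x_i-\mathbf x_c\|^{-\alpha_c},$$ where $|h_c|^2\ge0$ has mean $1$, $|h_i|^2\ge 0$ are the interfering channel gains, and $\mathbf x_i\in\mathbb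 R^2$ are the (random) positions of the interfering base stations (in particular those of a Poisson process). For a path loss exponent $\alpha_t$ and $1\le n\le m_t$ put $$\beta_1=\frac{n\eta_t\Upsilon\sigma^2}{P_bC_{RIS,E}^2},\qquad \beta_0(y)=\beta_1y^{\alpha_t},\qquad \beta_2=\pi\lambda_b\,{}_2F_1\Big(-\frac2{\alpha_t},m_t;1-\frac2{\alpha_t};-\frac{n\eta_t\Upsilon}{m_t}\Big),$$ with ${}_2F_1$ the Gauss hypergeometric function (continued analytically to $(-\infty,1)$), let $f_{r_{RU}}(y)=2y/R_L^2$ for $0\le y\le R_L$, and let the (approximate) coverage probability of the typical user be given by $$\mathbb P_t=2\pi\lambda_b\int_0^{R_L}\int_0^\infty\sum_{n=1}^{m_t}(-1)^{n+1}\binom{m_t}{n}\,x\,e^{-\beta_0(y)x^{\alpha_t}}e^{-\beta_2x^2}\,dx\,f_{r_{RU}}(y)\,dy .$$ If $\alpha_t=4$, then this double integral converges absolutely, and $\mathbb P_t$ is approximated by a closed form with $K$ Chebyshev-Gauss quadrature points, in the sense that $$\mathbb P_t=\lim_{K\to\infty}\ \sum_{n=1}^{m_t}(-1)^{n+1}\binom{m_t}{n}\sum_{i=1}^K\frac{\omega_i\,\pi^{3/2}\lambda_b\sqrt{1-\varpi_i^2}}{2R_L\sqrt{\beta_1}\,\Xi_i}\exp\Big(\frac{\beta_2^2}{4\beta_1\Xi_i^4}\Big)\operatorname{Erfc}\Big(\frac{\beta_2}{2\sqrt{\beta_1}\,\Xi_i^2}\Big),$$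 where $\varpi_i=\cos\big(\frac{2i-1}{2K}\pi\big)$, $\Xi_i=\frac{R_L}2(\varpi_i+1)$, $\omega_i=\pi/K$ and $\operatorname{Erfc}(z)=\frac2{\sqrt\pi}\int_z^\infty e^{-t^2}dt$. -/

import Mathlib

open MeasureTheory Filter Topology
open scoped ENNReal

noncomputable section

namespace RISNoma

/-- The complementary error function `(2 / √π) ∫_x^∞ exp (-t²) dt`. -/
def erfc (x : ℝ) : ℝ :=
  2 / Real.sqrt Real.pi * ∫ t in Set.Ioi x, Real.exp (-t ^ 2)

/-- `f` is the real-analytic continuation to `(-∞, 1)` of the Gauss hypergeometric series with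
parameters `a, b, c` (the series itself only converges on `(-1, 1)`). -/
def IsGaussHypergeometric (a b c : ℝ) (f : ℝ → ℝ) : Prop :=
  AnalyticOnNhd ℝ f (Set.Iio 1) ∧
    ∀ x ∈ Set.Ioo (-1 : ℝ) 1, f x = ordinaryHypergeometric a b c x

/-- The continuation is unique. -/
theorem IsGaussHypergeometric.eqOn {a b c : ℝ} {f g : ℝ → ℝ}
    (hf : IsGaussHypergeometric a b c f) (hg : IsGaussHypergeometric a b c g) :
    Set.EqOn f g (Set.Iio 1) := by
  refine hf.1.eqOn_of_preconnected_of_eventuallyEq hg.1 (isPreconnected_Iio)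
    (z₀ := 0) (by simp) ?_
  filter_upwards [Ioo_mem_nhds (show (-1 : ℝ) < 0 by norm_num) (show (0 : ℝ) < 1 by norm_num)]
    with x hx
  rw [hf.2 x hx, hg.2 x hx]

open Classical in
/-- The Gauss hypergeometric function `₂F₁(a, b; c; x)` for real `x < 1`: the value at `x` of the
(unique) real-analytic continuation of the hypergeometric series to `(-∞, 1)`. -/
def hyp2F1 (a b c x : ℝ) : ℝ :=
  if h : ∃ f : ℝ → ℝ, IsGaussHypergeometric a b c f then h.choose x else 0

/-- The plane, with the Euclidean distance. -/
abbrev Plane : Type := EuclideanSpace ℝ (Fin 2)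

/-- Deterministic parameters of the network. -/
structure Params where
  /-- density of the base stations -/
  lam : ℝ
  /-- transmit power of a base station -/
  Pb : ℝ
  /-- standard deviation of the noise, so that `sigma ^ 2` is its variance -/
  sigma : ℝ
  /-- half-length of the RIS -/
  L : ℝ
  /-- ratio of the angle of incidence to the base station-RIS-user angle -/
  rhoA : ℝ
  /-- radius of the RIS ball -/
  RL : ℝ
  /-- Nakagami coefficient of the typical user -/
  mt : ℕ
  /-- intercept of the direct links -/
  C : ℝ
  /-- path loss exponent of the direct links -/
  alphaC : ℝ
  /-- distance between the connected user and its base station -/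
  rc : ℝ
  /-- power allocation parameter of the connected user -/
  aC : ℝ
  /-- power allocation parameter of the typical user -/
  aT : ℝ
  /-- threshold of the SIC process -/
  gammaSIC : ℝ
  /-- threshold rate of the typical user -/
  Rt : ℝ
  /-- bandwidth -/
  Bw : ℝ

/-- The admissible ranges of the parameters. -/
structure Params.Admissible (N : Params) : Prop where
  lam_pos : 0 < N.lam
  Pb_pos : 0 < N.Pb
  sigma_pos : 0 < N.sigma
  L_pos : 0 < N.L
  rhoA_mem : N.rhoA ∈ Set.Ioo (0 : ℝ) 1
  RL_pos : 0 < N.RL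
  mt_pos : 1 ≤ N.mt
  C_pos : 0 < N.C
  rc_pos : 0 < N.rc
  aT_pos : 0 < N.aT
  aT_lt_aC : N.aT < N.aC
  aC_add_aT : N.aC + N.aT = 1
  gammaSIC_pos : 0 < N.gammaSIC
  /-- the SIC threshold is attainable -/
  gammaSIC_lt : N.gammaSIC * N.aT < N.aC
  Rt_pos : 0 < N.Rt
  Bw_pos : 0 < N.Bw

namespace Params

variable (N : Params)

/-- RIS coefficient when the base station-RIS-user angle is `θ`, the angle of incidence is
`ρ_a θ` and the angle of reflection is `(1 - ρ_a) θ`. -/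
def CRIS (θ : ℝ) : ℝ :=
  N.L / (4 * Real.pi) * (Real.cos (N.rhoA * θ) + Real.cos ((1 - N.rhoA) * θ))

/-- The averaged RIS coefficient: `CRISE ^ 2` is the mean of `CRIS θ ^ 2` for `θ` uniformly
distributed in `(0, π)`. -/
def CRISE : ℝ :=
  Real.sqrt (1 / Real.pi * ∫ θ in (0 : ℝ)..Real.pi, N.CRIS θ ^ 2)

/-- Coverage threshold `2 ^ (R_t / B_w) - 1` of the typical user. -/
def gammaT : ℝ := (2 : ℝ) ^ (N.Rt / N.Bw) - 1

/-- Interference at the connected user, located at `xc`: the interfering base stations are at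
the points `X i`, with channel power gains `H i`. -/
def interferenceC (xc : Plane) {Ω : Type*} (X : ℕ → Ω → Plane) (H : ℕ → Ω → ℝ) (ω : Ω) : ℝ≥0∞ :=
  ∑' i, ENNReal.ofReal (N.Pb * H i ω * N.C) * edist (X i ω) xc ^ (-N.alphaC)

/-- Mean received SINR of the connected user under orthogonal access; `G` is the channel power
gain of its serving link. -/
def gammaCE (xc : Plane) {Ω : Type*} [MeasurableSpace Ω] (P : Measure Ω) (G : Ω → ℝ)
    (X : ℕ → Ω → Plane) (H : ℕ → Ω → ℝ) : ℝ :=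
  (∫⁻ ω, ENNReal.ofReal (N.Pb * G ω * N.C * N.rc ^ (-N.alphaC)) /
    (N.interferenceC xc X H ω + ENNReal.ofReal (N.sigma ^ 2)) ∂P).toReal

/-- The overall threshold `Υ`, as a function of the mean SINR `gE` of the connected user. -/
def Upsilon (gE : ℝ) : ℝ :=
  max (max (N.gammaSIC / (N.aC - N.gammaSIC * N.aT)) (N.gammaT / N.aT)) gE

/-- `η_t = m_t (m_t !) ^ (-1 / m_t)`. -/
def eta : ℝ := N.mt * (N.mt.factorial : ℝ) ^ (-(1 : ℝ) / N.mt)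

/-- `β₁`, for the `n`-th term of the binomial sum and the threshold `U`. -/
def beta1 (U : ℝ) (n : ℕ) : ℝ :=
  n * N.eta * U * N.sigma ^ 2 / (N.Pb * N.CRISE ^ 2)

/-- `β₀ (y) = β₁ y ^ α_t`. -/
def beta0 (alphaT U : ℝ) (n : ℕ) (y : ℝ) : ℝ := N.beta1 U n * y ^ alphaT

/-- `β₂`, for the `n`-th term of the binomial sum and the threshold `U`. -/
def beta2 (alphaT U : ℝ) (n : ℕ) : ℝ :=
  Real.pi * N.lam *
    hyp2F1 (-2 / alphaT) N.mt (1 - 2 / alphaT) (-(n * N.eta * U / N.mt))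

/-- Density of the distance between the RIS and the typical user (at `y ≥ 0`). -/
def pdfRU (y : ℝ) : ℝ := 2 * y / N.RL ^ 2 * (if y ≤ N.RL then 1 else 0)

/-- The integrand of the coverage probability (`x`: distance from the base station to the RIS,
`y`: distance from the RIS to the typical user). -/
def integrand (alphaT U : ℝ) (x y : ℝ) : ℝ :=
  (∑ n ∈ Finset.Icc 1 N.mt, (-1 : ℝ) ^ (n + 1) * (N.mt.choose n : ℝ) * x *
    Real.exp (-N.beta0 alphaT U n y * x ^ alphaT) *
    Real.exp (-N.beta2 alphaT U n * x ^ 2)) * N.pdfRU y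

/-- The coverage probability of the typical user, as an integral over the two distances. -/
def coverageT (alphaT U : ℝ) : ℝ :=
  2 * Real.pi * N.lam *
    ∫ y in (0 : ℝ)..N.RL, ∫ x in Set.Ioi (0 : ℝ), N.integrand alphaT U x y

/-- Chebyshev node `ϖ_i` of the `K`-point rule. -/
def node (K i : ℕ) : ℝ := Real.cos ((2 * i - 1) / (2 * K) * Real.pi)

/-- `Ξ_i = (R_L / 2) (ϖ_i + 1)`. -/
def Xi (K i : ℕ) : ℝ := N.RL / 2 * (node K i + 1)

/-- Chebyshev-Gauss weight `ω_i = π / K`. -/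
def weight (K : ℕ) : ℝ := Real.pi / K

/-- The closed form of the coverage probability for `α_t = 4`, with `K` quadrature points. -/
def closedForm (U : ℝ) (K : ℕ) : ℝ :=
  ∑ n ∈ Finset.Icc 1 N.mt, (-1 : ℝ) ^ (n + 1) * (N.mt.choose n : ℝ) *
    ∑ i ∈ Finset.Icc 1 K,
      weight K * Real.pi ^ (3 / 2 : ℝ) * N.lam * Real.sqrt (1 - node K i ^ 2) /
          (2 * N.RL * Real.sqrt (N.beta1 U n) * N.Xi K i) *
        Real.exp (N.beta2 4 U n ^ 2 / (4 * N.beta1 U n * N.Xi K i ^ 4)) *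
        erfc (N.beta2 4 U n / (2 * Real.sqrt (N.beta1 U n) * N.Xi K i ^ 2))

end Params

end RISNoma

end

noncomputable section

/-! For `α_t = 4` the substitution `s = x²` turns the inner integral into a half-line Gaussian
integral, and completing the square gives an exponential times `erfc` (`quarticGaussian_eq`).
Putting `y = (R_L / 2)(cos θ + 1)` makes the outer integral one of a continuous function over `[0,
π]`. The `K`-point Chebyshev-Gauss sum is exactly the midpoint sum of that function
(`closedForm_summand_eq`), so the limit is the convergence of the midpoint rule.

Absolute convergence and continuity down to `y = 0`, where the quartic damping vanishes, rest on `β₂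
> 0`. This follows from `₂F₁(-1/2, m; 1/2; x) = 1 - x ∑_{j<m} ∫₀¹ (1 - x t²)^{-(j+1)} dt` for `x <
1` (`hyp2F1_eq_hypHalf`), whose right side is at least `1` when `x ≤ 0`. -/

namespace RISNoma

/-! ### Analytic continuation and positivity of `₂F₁(-1/2, m; 1/2; ·)` -/

/-- The map `z ↦ ∫₀¹ (1 - z t²)^{-(j+1)} dt` is holomorphic on the half-plane `re z < 1`. -/
theorem differentiableAt_integral_inv_pow (j : ℕ) {z₀ : ℂ} (hz₀ : z₀.re < 1) :
    DifferentiableAt ℂ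
      (fun z : ℂ => ∫ t in (0 : ℝ)..1, ((1 - z * (t : ℂ) ^ 2)⁻¹) ^ (j + 1)) z₀ := by
  -- `r` lies midway between `re z₀` and `1`. On `re z < r`, the real part of `1 - z t²` is at least
  -- `1` if `re z ≤ 0` and at least `1 - r` otherwise.
  set r : ℝ := (1 + z₀.re) / 2 with hr
  set δ : ℝ := min 1 (1 - r) with hδ
  have hδ0 : 0 < δ := lt_min one_pos (by linarith)
  have hlow : ∀ t ∈ Set.uIoc (0 : ℝ) 1, ∀ z ∈ {z : ℂ | z.re < r},
      δ ≤ ‖1 - z * (t : ℂ) ^ 2‖ := by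
    intro t ht z hz
    rw [Set.uIoc_of_le zero_le_one] at ht
    have h1 : (1 - z * (t : ℂ) ^ 2).re = 1 - z.re * t ^ 2 := by
      rw [← Complex.ofReal_pow, Complex.sub_re, Complex.re_mul_ofReal, Complex.one_re]
    refine le_trans ?_ (Complex.re_le_norm _)
    rw [h1]
    have ht2 : t ^ 2 ≤ 1 := by nlinarith [ht.1, ht.2]
    have ht0 : 0 ≤ t ^ 2 := sq_nonneg t
    have hz' : z.re < r := hz
    rcases le_total z.re 0 with h | h
    · exact (min_le_left _ _).trans (by nlinarith)
    · exact (min_le_right _ _).trans (by nlinarith)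
  have hne : ∀ t ∈ Set.uIoc (0 : ℝ) 1, ∀ z ∈ {z : ℂ | z.re < r}, 1 - z * (t : ℂ) ^ 2 ≠ 0 :=
    fun t ht z hz h => by
      have := hlow t ht z hz
      rw [h, norm_zero] at this
      linarith
  have hs : {z : ℂ | z.re < r} ∈ 𝓝 z₀ :=
    (isOpen_lt Complex.continuous_re continuous_const).mem_nhds (by
      change z₀.re < r; linarith)
  have hmeas : ∀ (k : ℕ) (z : ℂ), AEStronglyMeasurable
      (fun t : ℝ => ((1 - z * (t : ℂ) ^ 2)⁻¹) ^ k) (volume.restrict (Set.uIoc (0 : ℝ) 1)) := by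
    intro k z
    exact Measurable.aestronglyMeasurable (by fun_prop)
  have hbd : ∀ (k : ℕ), ∀ t ∈ Set.uIoc (0 : ℝ) 1, ∀ z ∈ {z : ℂ | z.re < r},
      ‖((1 - z * (t : ℂ) ^ 2)⁻¹) ^ k‖ ≤ (δ⁻¹) ^ k := by
    intro k t ht z hz
    rw [norm_pow, norm_inv]
    gcongr
    exact hlow t ht z hz
  have hz₀r : z₀ ∈ {z : ℂ | z.re < r} := mem_of_mem_nhds hs
  refine (intervalIntegral.hasDerivAt_integral_of_dominated_loc_of_deriv_le
    (F := fun (z : ℂ) (t : ℝ) => ((1 - z * (t : ℂ) ^ 2)⁻¹) ^ (j + 1))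
    (F' := fun (z : ℂ) (t : ℝ) =>
      ((j + 1 : ℕ) : ℂ) * (t : ℂ) ^ 2 * ((1 - z * (t : ℂ) ^ 2)⁻¹) ^ (j + 2))
    (bound := fun _ => ((j + 1 : ℕ) : ℝ) * (δ⁻¹) ^ (j + 2))
    hs (Eventually.of_forall fun z => hmeas _ z) ?_ ?_ ?_ ?_ ?_).2.differentiableAt
  · rw [intervalIntegrable_iff]
    refine Integrable.mono' (g := fun _ => (δ⁻¹) ^ (j + 1)) ?_ (hmeas _ _) ?_
    · exact (intervalIntegrable_iff.1 intervalIntegrable_const)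
    · exact (ae_restrict_iff' measurableSet_uIoc).2
        (Eventually.of_forall fun t ht => hbd _ t ht _ hz₀r)
  · exact Measurable.aestronglyMeasurable (by fun_prop)
  · refine Eventually.of_forall fun t ht z hz => ?_
    rw [norm_mul, norm_mul]
    have h1 : ‖(t : ℂ) ^ 2‖ ≤ 1 := by
      rw [Set.uIoc_of_le zero_le_one] at ht
      rw [norm_pow, Complex.norm_real, Real.norm_of_nonneg ht.1.le]
      exact pow_le_one₀ ht.1.le ht.2
    rw [Complex.norm_natCast]
    have h2 := hbd (j + 2) t ht z hz
    calc ((j + 1 : ℕ) : ℝ) * ‖(t : ℂ) ^ 2‖ * ‖((1 - z * (t : ℂ) ^ 2)⁻¹) ^ (j + 2)‖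
        ≤ ((j + 1 : ℕ) : ℝ) * 1 * (δ⁻¹) ^ (j + 2) := by gcongr
      _ = _ := by rw [mul_one]
  · exact intervalIntegrable_const
  · refine Eventually.of_forall fun t ht z hz => ?_
    have h1 : HasDerivAt (fun z : ℂ => 1 - z * (t : ℂ) ^ 2) (-(t : ℂ) ^ 2) z := by
      simpa using ((hasDerivAt_id z).mul_const ((t : ℂ) ^ 2)).const_sub 1
    have h2 := (h1.fun_inv (hne t ht z hz)).fun_pow (j + 1)
    refine h2.congr_deriv ?_
    rw [Nat.add_sub_cancel, neg_neg, div_eq_mul_inv, ← inv_pow]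
    ring

/-- `∫₀¹ (1 - x t²)^{-(j+1)} dt`. -/
def invPowIntegral (j : ℕ) (x : ℝ) : ℝ :=
  ∫ t in (0 : ℝ)..1, ((1 - x * t ^ 2)⁻¹) ^ (j + 1)

/-- Complex differentiability on an open half-plane gives analyticity for free; the real function is
the real part of its restriction to the real axis. -/
theorem analyticOnNhd_invPowIntegral (j : ℕ) :
    AnalyticOnNhd ℝ (invPowIntegral j) (Set.Iio 1) := by
  have h : AnalyticOnNhd ℂ
      (fun z : ℂ => ∫ t in (0 : ℝ)..1, ((1 - z * (t : ℂ) ^ 2)⁻¹) ^ (j + 1)) {z | z.re < 1} :=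
    DifferentiableOn.analyticOnNhd
      (fun z hz => (differentiableAt_integral_inv_pow j hz).differentiableWithinAt)
      (isOpen_lt Complex.continuous_re continuous_const)
  intro x hx
  have h2 := (h (x : ℂ) (by simpa using hx)).re_ofReal
  convert h2 using 2 with y
  rw [invPowIntegral, ← Complex.ofReal_re (∫ t in (0 : ℝ)..1, ((1 - y * t ^ 2)⁻¹) ^ (j + 1)),
    ← intervalIntegral.integral_ofReal]
  push_cast
  rfl

theorem invPowIntegral_nonneg (j : ℕ) {x : ℝ} (hx : x ≤ 0) : 0 ≤ invPowIntegral j x := by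
  refine intervalIntegral.integral_nonneg zero_le_one fun t _ => ?_
  have : 0 < 1 - x * t ^ 2 := by nlinarith [sq_nonneg t]
  positivity

/-- Termwise integration of the negative binomial series in `x t²`, dominated by its value at `t =
1` with `|x|`. -/
theorem hasSum_invPowIntegral (j : ℕ) {x : ℝ} (hx : |x| < 1) :
    HasSum (fun k : ℕ => ((k + j).choose j : ℝ) * x ^ k / (2 * k + 1)) (invPowIntegral j x) := by
  have key := intervalIntegral.hasSum_integral_of_dominated_convergence (a := 0) (b := 1)
    (μ := volume)
    (F := fun (k : ℕ) (t : ℝ) => ((k + j).choose j : ℝ) * (x * t ^ 2) ^ k)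
    (f := fun t => ((1 - x * t ^ 2)⁻¹) ^ (j + 1))
    (fun (k : ℕ) _ => ((k + j).choose j : ℝ) * |x| ^ k)
    (fun k => (by fun_prop : Continuous _).aestronglyMeasurable) ?_ ?_ ?_ ?_
  · convert! key using 1
    funext k
    have h1 : ∀ t : ℝ, ((k + j).choose j : ℝ) * (x * t ^ 2) ^ k
        = (((k + j).choose j : ℝ) * x ^ k) * t ^ (2 * k) := fun t => by ring
    simp_rw [h1]
    rw [intervalIntegral.integral_const_mul, integral_pow]
    simp
    ring
  · intro k
    refine Eventually.of_forall fun t ht => ?_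
    rw [Set.uIoc_of_le zero_le_one] at ht
    rw [norm_mul, norm_pow, norm_mul, Real.norm_natCast, norm_pow,
      Real.norm_of_nonneg ht.1.le, Real.norm_eq_abs]
    have : t ^ 2 ≤ 1 := pow_le_one₀ ht.1.le ht.2
    gcongr
    exact mul_le_of_le_one_right (abs_nonneg x) this
  · refine Eventually.of_forall fun t _ => ?_
    exact summable_choose_mul_geometric_of_norm_lt_one j (by simpa using hx)
  · exact intervalIntegrable_const
  · refine Eventually.of_forall fun t ht => ?_
    rw [Set.uIoc_of_le zero_le_one] at ht
    have h2 : ‖x * t ^ 2‖ < 1 := by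
      rw [norm_mul, norm_pow, Real.norm_of_nonneg ht.1.le, Real.norm_eq_abs]
      exact (mul_le_of_le_one_right (abs_nonneg x) (pow_le_one₀ ht.1.le ht.2)).trans_lt hx
    have h3 := hasSum_choose_mul_geometric_of_norm_lt_one j h2
    simpa [one_div, inv_pow] using h3

/-- Closed form of `₂F₁(-1/2, m; 1/2; x)` on `(-∞, 1)`. -/
def hypHalf (m : ℕ) (x : ℝ) : ℝ := 1 - x * ∑ j ∈ Finset.range m, invPowIntegral j x

theorem analyticOnNhd_hypHalf (m : ℕ) : AnalyticOnNhd ℝ (hypHalf m) (Set.Iio 1) := by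
  have h : AnalyticOnNhd ℝ (fun x => ∑ j ∈ Finset.range m, invPowIntegral j x) (Set.Iio 1) :=
    fun x hx => Finset.analyticAt_fun_sum _ fun j _ => analyticOnNhd_invPowIntegral j x hx
  exact analyticOnNhd_const.sub (analyticOnNhd_id.mul h)

theorem one_le_hypHalf (m : ℕ) {x : ℝ} (hx : x ≤ 0) : 1 ≤ hypHalf m x := by
  have := Finset.sum_nonneg (s := Finset.range m) fun j _ => invPowIntegral_nonneg j hx
  rw [hypHalf]
  nlinarith

/-- Both symbols share the factor `(m+1)_k`: the remaining factors are `m+1+k` and `m`, which differ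
by `k+1`. -/
theorem ascPochhammer_eval_succ_add_one (m k : ℕ) :
    ((ascPochhammer ℝ (k + 1)).eval ((m + 1 : ℕ) : ℝ)) =
      (ascPochhammer ℝ (k + 1)).eval (m : ℝ) + (k + 1) * (k.factorial * (k + m).choose m) := by
  have h1 : (ascPochhammer ℝ k).eval ((m : ℝ) + 1) = k.factorial * (k + m).choose m := by
    have := ascPochhammer_nat_eq_natCast_ascFactorial ℝ (m + 1) k
    push_cast at this
    rw [this]
    have h2 := Nat.ascFactorial_eq_factorial_mul_choose m k
    rw [h2, add_comm m k, Nat.choose_symm_add]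
    push_cast
    rfl
  rw [← h1, ascPochhammer_succ_eval, ascPochhammer_succ_left]
  simp
  ring

/-- Induction on `m`: for `m = 0` only the constant term survives, and raising `m` by one adds the
series of `-x * invPowIntegral m x`. -/
theorem hasSum_hypHalf (m : ℕ) {x : ℝ} (hx : |x| < 1) :
    HasSum (fun k : ℕ => (k.factorial : ℝ)⁻¹ * (ascPochhammer ℝ k).eval (m : ℝ) *
      (-(2 * k - 1 : ℝ)⁻¹) * x ^ k) (hypHalf m x) := by
  induction m with
  | zero =>
    convert hasSum_single (0 : ℕ) ?_ using 1
    · simp [hypHalf]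
    · intro k hk
      simp [hk]
  | succ m ih =>
    -- Multiplication by `x` shifts the index; the guard at `k = 0` hides the truncated `k - 1`.
    have h1 : HasSum (fun k : ℕ => if k = 0 then 0 else
        -x * (((k - 1 + m).choose m : ℝ) * x ^ (k - 1) / (2 * (k - 1 : ℕ) + 1)))
        (-x * invPowIntegral m x) := by
      rw [← hasSum_nat_add_iff' 1]
      simpa using (hasSum_invPowIntegral m hx).mul_left (-x)
    have h2 := ih.add h1
    convert h2 using 1
    · funext k
      rcases k with _ | k
      · simp
      · rw [ascPochhammer_eval_succ_add_one, Nat.factorial_succ]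
        have hf : (k.factorial : ℝ) ≠ 0 := by positivity
        have hk : (2 * (k : ℝ) + 1) ≠ 0 := by positivity
        have hk' : (2 * ((k : ℝ) + 1) - 1) ≠ 0 := by
          have : (2 * ((k : ℝ) + 1) - 1) = 2 * k + 1 := by ring
          rwa [this]
        have hk1 : ((k : ℝ) + 1) ≠ 0 := by positivity
        have e : (2 * ((k : ℝ) + 1) - 1) = 2 * k + 1 := by ring
        simp only [Nat.add_eq_zero_iff, one_ne_zero, and_false, if_false, Nat.add_sub_cancel]
        push_cast
        rw [e]
        field_simp
        ring
    · rw [hypHalf, hypHalf, Finset.sum_range_succ]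
      ring

theorem ascPochhammer_eval_half_pos (k : ℕ) : 0 < (ascPochhammer ℝ k).eval (1 / 2 : ℝ) :=
  ascPochhammer_pos _ _ (by norm_num)

/-- The ratio `(-1/2)_k / (1/2)_k` telescopes to `-1 / (2k - 1)`, the coefficient used in
`hasSum_hypHalf`. -/
theorem ascPochhammer_eval_neg_half (k : ℕ) :
    (ascPochhammer ℝ k).eval (-1 / 2 : ℝ) * (2 * k - 1) =
      -(ascPochhammer ℝ k).eval (1 / 2 : ℝ) := by
  induction k with
  | zero => simp
  | succ k ih =>
    rw [ascPochhammer_succ_eval, ascPochhammer_succ_eval]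
    push_cast
    linear_combination (k + 1 / 2 : ℝ) * ih

theorem isGaussHypergeometric_hypHalf (m : ℕ) :
    IsGaussHypergeometric (-1 / 2) m (1 / 2) (hypHalf m) := by
  refine ⟨analyticOnNhd_hypHalf m, fun x hx => ?_⟩
  rw [ordinaryHypergeometric_eq_tsum, ← (hasSum_hypHalf m (abs_lt.2 hx)).tsum_eq]
  refine tsum_congr fun k => ?_
  have h1 := ascPochhammer_eval_neg_half k
  have h2 := (ascPochhammer_eval_half_pos k).ne'
  have h3 : (2 * k - 1 : ℝ) ≠ 0 := fun h => by
    rw [h, mul_zero] at h1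
    exact h2 (by linarith)
  have h4 : (ascPochhammer ℝ k).eval (-1 / 2 : ℝ) * ((ascPochhammer ℝ k).eval (1 / 2 : ℝ))⁻¹ =
      -(2 * k - 1 : ℝ)⁻¹ := by
    field_simp
    linarith
  rw [← h4, smul_eq_mul]
  ring

theorem hyp2F1_eq_hypHalf (m : ℕ) {x : ℝ} (hx : x < 1) :
    hyp2F1 (-1 / 2) m (1 / 2) x = hypHalf m x := by
  have hex : ∃ f : ℝ → ℝ, IsGaussHypergeometric (-1 / 2) m (1 / 2) f :=
    ⟨_, isGaussHypergeometric_hypHalf m⟩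
  rw [hyp2F1, dif_pos hex]
  exact hex.choose_spec.eqOn (isGaussHypergeometric_hypHalf m) hx

theorem hyp2F1_half_pos (m : ℕ) {x : ℝ} (hx : x ≤ 0) : 0 < hyp2F1 (-1 / 2) m (1 / 2) x := by
  rw [hyp2F1_eq_hypHalf m (by linarith)]
  exact zero_lt_one.trans_le (one_le_hypHalf m hx)

/-! ### Convergence of the midpoint rule -/

/-- The midpoint rule converges for continuous functions on `[0, b]`. -/
theorem tendsto_midpoint_rule {f : ℝ → ℝ} (hf : Continuous f) {b : ℝ} (hb : 0 < b) :
    Tendsto (fun K : ℕ => ∑ i ∈ Finset.range K, b / K * f ((2 * i + 1) / (2 * K) * b))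
      atTop (𝓝 (∫ t in (0 : ℝ)..b, f t)) := by
  rw [Metric.tendsto_atTop]
  intro ε hε
  have huc : UniformContinuousOn f (Set.Icc 0 b) :=
    isCompact_Icc.uniformContinuousOn_of_continuous hf.continuousOn
  rw [Metric.uniformContinuousOn_iff] at huc
  -- An oscillation of `ε / (2b)` on each cell gives total error at most `ε / 2`, keeping the final
  -- inequality strict.
  obtain ⟨δ, hδ, h⟩ := huc (ε / (2 * b)) (by positivity)
  obtain ⟨M, hM⟩ := exists_nat_gt (b / δ)
  refine ⟨M + 1, fun K hK => ?_⟩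
  have hK0 : (0 : ℝ) < K := by exact_mod_cast (by omega : 0 < K)
  have hKδ : b / K < δ := by
    rw [div_lt_iff₀ hK0]
    rw [div_lt_iff₀ hδ] at hM
    have : (M : ℝ) ≤ K := by exact_mod_cast (by omega : M ≤ K)
    nlinarith
  set a : ℕ → ℝ := fun i => b / K * i with ha
  have hsplit : ∫ t in (0 : ℝ)..b, f t =
      ∑ i ∈ Finset.range K, ∫ t in a i..a (i + 1), f t := by
    rw [intervalIntegral.sum_integral_adjacent_intervals
      (fun i _ => hf.intervalIntegrable _ _)]
    simp only [ha, Nat.cast_zero, mul_zero]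
    rw [div_mul_cancel₀ _ hK0.ne']
  have hterm : ∀ i ∈ Finset.range K,
      ‖b / K * f ((2 * i + 1) / (2 * K) * b) - ∫ t in a i..a (i + 1), f t‖ ≤
        ε / (2 * b) * (b / K) := by
    intro i hi
    have hiK : (i : ℝ) + 1 ≤ K := by exact_mod_cast (Finset.mem_range.1 hi)
    have hw : a (i + 1) - a i = b / K := by simp only [ha]; push_cast; ring
    have hbK : 0 < b / K := by positivity
    have ha0 : 0 ≤ a i := by positivity
    have haK : a (i + 1) ≤ b := by
      simp only [ha]; push_cast
      calc b / K * (i + 1) ≤ b / K * K := by gcongr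
        _ = b := div_mul_cancel₀ _ hK0.ne'
    have hle : a i ≤ a (i + 1) := by linarith
    have hmid : (2 * i + 1) / (2 * K) * b = a i + b / K / 2 := by
      simp only [ha]; field_simp
    have hc : b / K * f ((2 * i + 1) / (2 * K) * b) =
        ∫ _ in a i..a (i + 1), f ((2 * i + 1) / (2 * K) * b) := by
      rw [intervalIntegral.integral_const, hw, smul_eq_mul]
    rw [hc, ← intervalIntegral.integral_sub intervalIntegrable_const
      (hf.intervalIntegrable _ _)]
    have := intervalIntegral.norm_integral_le_of_norm_le_const (a := a i) (b := a (i + 1))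
      (C := ε / (2 * b)) (f := fun t => f ((2 * i + 1) / (2 * K) * b) - f t) ?_
    · rwa [hw, abs_of_pos hbK] at this
    · intro t ht
      rw [Set.uIoc_of_le hle] at ht
      rw [hmid, ← dist_eq_norm]
      refine (h _ ⟨by linarith, by linarith⟩ _ ⟨by linarith [ht.1], by linarith [ht.2]⟩ ?_).le
      rw [Real.dist_eq, abs_lt]
      constructor <;> linarith [ht.1, ht.2]
  rw [dist_eq_norm, hsplit, ← Finset.sum_sub_distrib]
  calc _ ≤ ∑ i ∈ Finset.range K, ε / (2 * b) * (b / K) := norm_sum_le_of_le _ hterm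
    _ = ε / 2 := by
      rw [Finset.sum_const, Finset.card_range, nsmul_eq_mul]; field_simp
    _ < ε := by linarith

/-! ### The inner integral in closed form -/

theorem integral_Ioi_mul_comp_sq (g : ℝ → ℝ) :
    ∫ x in Set.Ioi (0 : ℝ), x * g (x ^ 2) = 1 / 2 * ∫ s in Set.Ioi (0 : ℝ), g s := by
  rw [← integral_comp_rpow_Ioi_of_pos (g := g) (p := 2) (by norm_num), ← integral_const_mul]
  refine setIntegral_congr_fun measurableSet_Ioi fun x _ => ?_
  have h1 : x ^ ((2 : ℝ) - 1) = x := by norm_num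
  have h2 : x ^ (2 : ℝ) = x ^ 2 := Real.rpow_two x
  simp only [h1, h2, smul_eq_mul]
  ring

theorem integral_Ioi_exp_neg_quadratic {b : ℝ} (hb : 0 < b) (c : ℝ) :
    ∫ s in Set.Ioi (0 : ℝ), Real.exp (-b * s ^ 2 - c * s) =
      Real.sqrt Real.pi / (2 * Real.sqrt b) * Real.exp (c ^ 2 / (4 * b)) *
        erfc (c / (2 * Real.sqrt b)) := by
  have hsb : 0 < Real.sqrt b := Real.sqrt_pos.2 hb
  have hsq : Real.sqrt b ^ 2 = b := Real.sq_sqrt hb.le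
  have hpi : 0 < Real.sqrt Real.pi := Real.sqrt_pos.2 Real.pi_pos
  set d : ℝ := c / (2 * Real.sqrt b) with hd
  have h1 : ∀ s : ℝ, Real.exp (-b * s ^ 2 - c * s) =
      Real.exp (c ^ 2 / (4 * b)) * Real.exp (-(Real.sqrt b * s + d) ^ 2) := by
    intro s
    rw [← Real.exp_add]
    congr 1
    have e1 : c ^ 2 / (4 * b) = d ^ 2 := by rw [hd, div_pow, mul_pow, hsq]; norm_num
    have e2 : c = 2 * (Real.sqrt b * d) := by rw [hd]; field_simp
    rw [e1]
    linear_combination (s ^ 2) * hsq - s * e2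
  simp_rw [h1]
  rw [integral_const_mul]
  have h2 : ∫ s in Set.Ioi (0 : ℝ), Real.exp (-(Real.sqrt b * s + d) ^ 2) =
      (Real.sqrt b)⁻¹ * ∫ t in Set.Ioi d, Real.exp (-t ^ 2) := by
    rw [integral_comp_mul_left_Ioi (fun u => Real.exp (-(u + d) ^ 2)) 0 hsb, mul_zero,
      smul_eq_mul]
    congr 1
    have := (measurePreserving_add_right volume d).setIntegral_preimage_emb
      (measurableEmbedding_addRight d) (fun t => Real.exp (-t ^ 2)) (Set.Ioi d)
    rw [← this]
    simp
  rw [h2, erfc]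
  field_simp

/-- `∫₀^∞ x exp (-b x⁴) exp (-c x²) dx`. -/
def quarticGaussian (b c : ℝ) : ℝ :=
  ∫ x in Set.Ioi (0 : ℝ), x * Real.exp (-b * x ^ 4) * Real.exp (-c * x ^ 2)

theorem quarticGaussian_eq {b : ℝ} (hb : 0 < b) (c : ℝ) :
    quarticGaussian b c = Real.sqrt Real.pi / (4 * Real.sqrt b) * Real.exp (c ^ 2 / (4 * b)) *
        erfc (c / (2 * Real.sqrt b)) := by
  have h : ∀ x : ℝ, x * Real.exp (-b * x ^ 4) * Real.exp (-c * x ^ 2) =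
      x * (fun s => Real.exp (-b * s ^ 2 - c * s)) (x ^ 2) := by
    intro x
    simp only
    rw [mul_assoc, ← Real.exp_add]
    ring_nf
  rw [quarticGaussian]
  rw [integral_congr_ae (Eventually.of_forall h),
    integral_Ioi_mul_comp_sq (fun s => Real.exp (-b * s ^ 2 - c * s)),
    integral_Ioi_exp_neg_quadratic hb]
  ring

theorem integrableOn_mul_exp_neg_sq {c : ℝ} (hc : 0 < c) :
    IntegrableOn (fun x : ℝ => x * Real.exp (-c * x ^ 2)) (Set.Ioi 0) :=
  (integrable_mul_exp_neg_mul_sq hc).integrableOn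

theorem norm_quarticGaussian_integrand_le {b : ℝ} (hb : 0 ≤ b) (c : ℝ) {x : ℝ} (hx : 0 < x) :
    ‖x * Real.exp (-b * x ^ 4) * Real.exp (-c * x ^ 2)‖ ≤ x * Real.exp (-c * x ^ 2) := by
  rw [Real.norm_of_nonneg (by positivity)]
  have : Real.exp (-b * x ^ 4) ≤ 1 := Real.exp_le_one_iff.2 (by
    have : 0 ≤ b * x ^ 4 := by positivity
    linarith)
  gcongr
  exact mul_le_of_le_one_right hx.le this

theorem integrableOn_quarticGaussian {b c : ℝ} (hb : 0 ≤ b) (hc : 0 < c) :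
    IntegrableOn (fun x : ℝ => x * Real.exp (-b * x ^ 4) * Real.exp (-c * x ^ 2))
      (Set.Ioi 0) :=
  (integrableOn_mul_exp_neg_sq hc).mono' (by fun_prop)
    ((ae_restrict_iff' measurableSet_Ioi).2
      (Eventually.of_forall fun _ hx => norm_quarticGaussian_integrand_le hb c hx))

/-- The dominating function does not involve `b`, so continuity includes points where `b y = 0`,
which `quarticGaussian_eq` does not cover. -/
theorem continuous_quarticGaussian_comp {b : ℝ → ℝ} (hb : Continuous b) (hb0 : ∀ y, 0 ≤ b y)
    {c : ℝ} (hc : 0 < c) : Continuous fun y => quarticGaussian (b y) c := by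
  refine continuous_of_dominated (bound := fun x => x * Real.exp (-c * x ^ 2)) ?_ ?_
    (integrableOn_mul_exp_neg_sq hc) ?_
  · intro y; fun_prop
  · exact fun y => (ae_restrict_iff' measurableSet_Ioi).2
      (Eventually.of_forall fun _ hx => norm_quarticGaussian_integrand_le (hb0 y) c hx)
  · exact Eventually.of_forall fun x => by fun_prop

/-! ### Passage to the angular variable -/

/-- The substitution `y = (R / 2) (cos θ + 1)`. -/
theorem integral_eq_integral_cos {g : ℝ → ℝ} (hg : Continuous g) (R : ℝ) :
    ∫ y in (0 : ℝ)..R, g y =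
      ∫ θ in (0 : ℝ)..Real.pi, R / 2 * Real.sin θ * g (R / 2 * (Real.cos θ + 1)) := by
  have h := intervalIntegral.integral_comp_mul_deriv (a := 0) (b := Real.pi)
    (f := fun θ => R / 2 * (Real.cos θ + 1)) (f' := fun θ => R / 2 * -Real.sin θ) (g := g)
    (fun θ _ => ((Real.hasDerivAt_cos θ).add_const 1).const_mul (R / 2))
    (by fun_prop) hg
  simp only [Real.cos_zero, Real.cos_pi, Function.comp] at h
  have e1 : R / 2 * (1 + 1) = R := by ring
  have e2 : R / 2 * (-1 + 1) = 0 := by ring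
  rw [e1, e2] at h
  rw [intervalIntegral.integral_symm, ← h, ← intervalIntegral.integral_neg]
  refine intervalIntegral.integral_congr fun θ _ => ?_
  ring

/-! ### Positivity of the network constants and absolute convergence -/

namespace Params

variable {N : Params}

/-- The integrand is continuous, nonnegative and nonzero at `θ = 0`. -/
theorem Admissible.CRISE_sq_pos (hN : N.Admissible) : 0 < N.CRISE ^ 2 := by
  have hcont : Continuous fun θ => N.CRIS θ ^ 2 := by unfold CRIS; fun_prop
  have hI : 0 < ∫ θ in (0 : ℝ)..Real.pi, N.CRIS θ ^ 2 := by
    refine intervalIntegral.integral_pos Real.pi_pos hcont.continuousOn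
      (fun θ _ => sq_nonneg _) ⟨0, ⟨le_rfl, Real.pi_pos.le⟩, ?_⟩
    have hL := hN.L_pos
    have := Real.pi_pos
    simp only [CRIS, mul_zero, Real.cos_zero]
    positivity
  have hpos : 0 < 1 / Real.pi * ∫ θ in (0 : ℝ)..Real.pi, N.CRIS θ ^ 2 :=
    mul_pos (by have := Real.pi_pos; positivity) hI
  exact pow_pos (Real.sqrt_pos.2 hpos) 2

/-- The SIC entry of the maximum is positive, whatever the mean SINR. -/
theorem Admissible.Upsilon_pos (hN : N.Admissible) (g : ℝ) : 0 < N.Upsilon g :=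
  lt_max_of_lt_left (lt_max_of_lt_left
    (div_pos hN.gammaSIC_pos (sub_pos.2 hN.gammaSIC_lt)))

theorem Admissible.eta_pos (hN : N.Admissible) : 0 < N.eta :=
  mul_pos (by exact_mod_cast hN.mt_pos)
    (Real.rpow_pos_of_pos (by exact_mod_cast N.mt.factorial_pos) _)

theorem Admissible.beta1_pos (hN : N.Admissible) {U : ℝ} (hU : 0 < U) {n : ℕ} (hn : 1 ≤ n) :
    0 < N.beta1 U n := by
  have hn' : (0 : ℝ) < n := by exact_mod_cast hn
  have h1 := hN.eta_pos
  have h2 := hN.sigma_pos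
  have h3 := hN.Pb_pos
  have h4 := hN.CRISE_sq_pos
  rw [beta1]
  positivity

theorem Admissible.beta2_four_pos (hN : N.Admissible) {U : ℝ} (hU : 0 < U) (n : ℕ) :
    0 < N.beta2 4 U n := by
  have h1 := hN.eta_pos
  have h2 := hN.lam_pos
  have h3 : 0 < hyp2F1 (-2 / 4) N.mt (1 - 2 / 4) (-(n * N.eta * U / N.mt)) := by
    have e1 : (-2 / 4 : ℝ) = -1 / 2 := by norm_num
    have e2 : (1 - 2 / 4 : ℝ) = 1 / 2 := by norm_num
    rw [e1, e2]
    refine hyp2F1_half_pos _ (neg_nonpos.2 ?_)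
    positivity
  have := Real.pi_pos
  rw [beta2]
  positivity

theorem integrand_four_eq (U x y : ℝ) :
    N.integrand 4 U x y = ∑ n ∈ Finset.Icc 1 N.mt, (-1 : ℝ) ^ (n + 1) * (N.mt.choose n : ℝ) *
      (x * Real.exp (-(N.beta1 U n * y ^ 4) * x ^ 4) * Real.exp (-N.beta2 4 U n * x ^ 2)) *
        N.pdfRU y := by
  have h : ∀ z : ℝ, z ^ (4 : ℝ) = z ^ 4 := fun z => by norm_num [Real.rpow_ofNat]
  simp only [integrand, beta0, h, Finset.sum_mul, mul_assoc]

theorem measurable_pdfRU : Measurable N.pdfRU := by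
  have : Measurable fun y : ℝ => if y ≤ N.RL then (1 : ℝ) else 0 :=
    Measurable.ite measurableSet_Iic measurable_const measurable_const
  unfold pdfRU
  fun_prop

theorem pdfRU_of_le {y : ℝ} (hy : y ≤ N.RL) : N.pdfRU y = 2 * y / N.RL ^ 2 := by
  rw [pdfRU, if_pos hy, mul_one]

/-- Dropping the quartic exponential bounds each summand by a product of a function of `x` and a
function of `y`. -/
theorem Admissible.integrableOn_integrand (hN : N.Admissible) {U : ℝ} (hU : 0 < U) :
    IntegrableOn (fun p : ℝ × ℝ => N.integrand 4 U p.1 p.2)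
      (Set.Ioi 0 ×ˢ Set.Ioc 0 N.RL) := by
  have hR := hN.RL_pos
  simp only [integrand_four_eq]
  refine integrable_finsetSum _ fun n hn => ?_
  have hn1 : 1 ≤ n := (Finset.mem_Icc.1 hn).1
  have hb1 := hN.beta1_pos hU hn1
  have hdom : IntegrableOn (fun p : ℝ × ℝ =>
      (N.mt.choose n * (p.1 * Real.exp (-N.beta2 4 U n * p.1 ^ 2))) * (2 * p.2 / N.RL ^ 2))
      (Set.Ioi 0 ×ˢ Set.Ioc 0 N.RL) := by
    rw [IntegrableOn, Measure.volume_eq_prod, ← Measure.prod_restrict]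
    refine Integrable.mul_prod
      (f := fun x : ℝ => N.mt.choose n * (x * Real.exp (-N.beta2 4 U n * x ^ 2)))
      (g := fun y : ℝ => 2 * y / N.RL ^ 2)
      ((integrableOn_mul_exp_neg_sq (hN.beta2_four_pos hU n)).const_mul _) ?_
    exact (Continuous.integrableOn_Ioc (by fun_prop))
  refine hdom.mono' ?_ ?_
  · have := N.measurable_pdfRU
    exact Measurable.aestronglyMeasurable (by fun_prop)
  · refine (ae_restrict_iff' (measurableSet_Ioi.prod measurableSet_Ioc)).2
      (Eventually.of_forall fun p hp => ?_)
    have hx : 0 < p.1 := hp.1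
    have hy : 0 < p.2 := hp.2.1
    rw [pdfRU_of_le hp.2.2, norm_mul, norm_mul, norm_mul, norm_pow, norm_neg, norm_one, one_pow,
      one_mul, Real.norm_natCast, Real.norm_of_nonneg (by positivity : 0 ≤ 2 * p.2 / N.RL ^ 2)]
    gcongr
    exact norm_quarticGaussian_integrand_le (by positivity) _ hx

theorem Admissible.coverageT_four_eq (hN : N.Admissible) {U : ℝ} (hU : 0 < U) :
    N.coverageT 4 U = ∑ n ∈ Finset.Icc 1 N.mt, (-1 : ℝ) ^ (n + 1) * (N.mt.choose n : ℝ) *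
      ∫ y in (0 : ℝ)..N.RL, 2 * Real.pi * N.lam *
        (quarticGaussian (N.beta1 U n * y ^ 4) (N.beta2 4 U n) * (2 * y / N.RL ^ 2)) := by
  have hR := hN.RL_pos
  have hinner : ∀ y ∈ Set.uIcc 0 N.RL,
      ∫ x in Set.Ioi (0 : ℝ), N.integrand 4 U x y =
        ∑ n ∈ Finset.Icc 1 N.mt, (-1 : ℝ) ^ (n + 1) * (N.mt.choose n : ℝ) *
          (quarticGaussian (N.beta1 U n * y ^ 4) (N.beta2 4 U n) * (2 * y / N.RL ^ 2)) := by
    intro y hy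
    rw [Set.uIcc_of_le hR.le] at hy
    simp only [integrand_four_eq]
    have hint : ∀ n ∈ Finset.Icc 1 N.mt, IntegrableOn (fun x : ℝ =>
        x * Real.exp (-(N.beta1 U n * y ^ 4) * x ^ 4) * Real.exp (-N.beta2 4 U n * x ^ 2))
        (Set.Ioi 0) := fun n hn => by
      have hb1 := hN.beta1_pos hU (Finset.mem_Icc.1 hn).1
      exact integrableOn_quarticGaussian (by positivity) (hN.beta2_four_pos hU n)
    rw [integral_finsetSum _ fun n hn => ((hint n hn).const_mul _).mul_const _]
    refine Finset.sum_congr rfl fun n hn => ?_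
    rw [integral_mul_const, integral_const_mul, pdfRU_of_le hy.2, quarticGaussian, mul_assoc]
  rw [coverageT, intervalIntegral.integral_congr hinner,
    intervalIntegral.integral_finsetSum, Finset.mul_sum]
  · refine Finset.sum_congr rfl fun n _ => ?_
    rw [intervalIntegral.integral_const_mul, intervalIntegral.integral_const_mul]
    ring
  · intro n hn
    have hb1 := hN.beta1_pos hU (Finset.mem_Icc.1 hn).1
    have := continuous_quarticGaussian_comp (b := fun y => N.beta1 U n * y ^ 4) (by fun_prop)
      (fun y => by positivity) (hN.beta2_four_pos hU n)
    exact Continuous.intervalIntegrable (by fun_prop) _ _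

/-! ### Chebyshev-Gauss sums as midpoint sums -/

/-- Each Chebyshev-Gauss summand is a midpoint-rule summand in the angle. -/
theorem Admissible.closedForm_summand_eq (hN : N.Admissible) {b : ℝ} (hb : 0 < b) (c : ℝ)
    {K i : ℕ} (hi : i < K) :
    weight K * Real.pi ^ (3 / 2 : ℝ) * N.lam * Real.sqrt (1 - node K (1 + i) ^ 2) /
          (2 * N.RL * Real.sqrt b * N.Xi K (1 + i)) *
        Real.exp (c ^ 2 / (4 * b * N.Xi K (1 + i) ^ 4)) *
        erfc (c / (2 * Real.sqrt b * N.Xi K (1 + i) ^ 2)) =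
      Real.pi / K * (fun θ => N.RL / 2 * Real.sin θ * (fun y => 2 * Real.pi * N.lam *
        (quarticGaussian (b * y ^ 4) c * (2 * y / N.RL ^ 2))) (N.RL / 2 * (Real.cos θ + 1)))
        ((2 * i + 1) / (2 * K) * Real.pi) := by
  have hR := hN.RL_pos
  have hpi := Real.pi_pos
  have hK : (0 : ℝ) < K := by exact_mod_cast (by omega : 0 < K)
  have hiK : (i : ℝ) + 1 ≤ K := by exact_mod_cast hi
  set θ : ℝ := (2 * i + 1) / (2 * K) * Real.pi with hθ
  have hθ0 : 0 ≤ θ := by positivity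
  have hθ1 : θ < Real.pi := by
    rw [hθ]
    refine mul_lt_of_lt_one_left hpi ?_
    rw [div_lt_one (by positivity)]
    linarith
  have hnode : node K (1 + i) = Real.cos θ := by
    rw [node, hθ]
    congr 3
    push_cast
    ring
  -- No node reaches `θ = π`, so `Ξ_i > 0` and the divisions by it are genuine.
  have hcos : -1 < Real.cos θ := by
    rw [← Real.cos_pi]
    exact Real.cos_lt_cos_of_nonneg_of_le_pi hθ0 le_rfl hθ1
  have hXi : N.Xi K (1 + i) = N.RL / 2 * (Real.cos θ + 1) := by rw [Xi, hnode]
  simp only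
  rw [hnode, ← Real.sin_eq_sqrt_one_sub_cos_sq hθ0 hθ1.le, hXi]
  set y : ℝ := N.RL / 2 * (Real.cos θ + 1) with hy
  have hy0 : 0 < y := mul_pos (by positivity) (by linarith)
  have hsb : 0 < Real.sqrt b := Real.sqrt_pos.2 hb
  have hsq : Real.sqrt (b * y ^ 4) = Real.sqrt b * y ^ 2 := by
    rw [Real.sqrt_mul hb.le, show y ^ 4 = (y ^ 2) ^ 2 by ring, Real.sqrt_sq (by positivity)]
  have hpi32 : Real.pi ^ (3 / 2 : ℝ) = Real.pi * Real.sqrt Real.pi := by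
    rw [Real.sqrt_eq_rpow, show (3 / 2 : ℝ) = 1 + 1 / 2 by norm_num, Real.rpow_add hpi,
      Real.rpow_one]
  rw [quarticGaussian_eq (by positivity), hsq, hpi32, weight, ← mul_assoc 2 (Real.sqrt b),
    ← mul_assoc 4 b]
  generalize Real.exp _ = E
  generalize erfc _ = F
  field_simp
  ring

theorem Admissible.tendsto_closedForm (hN : N.Admissible) {U : ℝ} (hU : 0 < U) :
    Tendsto (fun K : ℕ => N.closedForm U K) atTop (𝓝 (N.coverageT 4 U)) := by
  rw [hN.coverageT_four_eq hU]
  simp only [closedForm]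
  refine tendsto_finsetSum _ fun n hn => Tendsto.const_mul _ ?_
  have hb1 := hN.beta1_pos hU (Finset.mem_Icc.1 hn).1
  have hcont : Continuous fun y : ℝ => 2 * Real.pi * N.lam *
      (quarticGaussian (N.beta1 U n * y ^ 4) (N.beta2 4 U n) * (2 * y / N.RL ^ 2)) := by
    have := continuous_quarticGaussian_comp (b := fun y => N.beta1 U n * y ^ 4) (by fun_prop)
      (fun y => by positivity) (hN.beta2_four_pos hU n)
    fun_prop
  rw [integral_eq_integral_cos hcont]
  refine (tendsto_midpoint_rule ((by fun_prop : Continuous fun θ => N.RL / 2 * Real.sin θ).mul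
    (hcont.comp (by fun_prop : Continuous fun θ => N.RL / 2 * (Real.cos θ + 1))))
    Real.pi_pos).congr fun K => ?_
  -- Nodes are numbered from `1`, midpoints from `0`: `2(i + 1) - 1 = 2i + 1`.
  rw [← Finset.Ico_add_one_right_eq_Icc, Finset.sum_Ico_eq_sum_range, Nat.add_sub_cancel]
  exact Finset.sum_congr rfl fun i hi =>
    (hN.closedForm_summand_eq hb1 _ (Finset.mem_range.1 hi)).symm

end Params

end RISNoma

end

theorem corollary1
    (N : RISNoma.Params) (hN : N.Admissible)
    {Ω : Type*} [MeasurableSpace Ω] (P : Measure Ω) [IsProbabilityMeasure P]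
    (xc : RISNoma.Plane)
    (G : Ω → ℝ) (hG : Measurable G) (hG0 : ∀ ω, 0 ≤ G ω) (hG1 : ∫⁻ ω, ENNReal.ofReal (G ω) ∂P = 1)
    (X : ℕ → Ω → RISNoma.Plane) (hX : ∀ i, Measurable (X i))
    (H : ℕ → Ω → ℝ) (hH : ∀ i, Measurable (H i)) (hH0 : ∀ i ω, 0 ≤ H i ω)
    (U : ℝ) (hU : U = N.Upsilon (N.gammaCE xc P G X H)) :
    IntegrableOn (fun p : ℝ × ℝ => N.integrand 4 U p.1 p.2)
      (Set.Ioi 0 ×ˢ Set.Ioc 0 N.RL) ∧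
    Tendsto (fun K : ℕ => N.closedForm U K) atTop (𝓝 (N.coverageT 4 U)) := by
  have hU0 : 0 < U := hU ▸ hN.Upsilon_pos _
  exact ⟨hN.integrableOn_integrand hU0, hN.tendsto_closedForm hU0⟩
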